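/- Let $K$ be a field and let $L$ be a finite (non-empty) lattice with minimum $m$; joins of subsets of $L$ are denoted by $\bigvee$, with $\bigvee\emptyset=m$. Let $A=KL$ be the incidence algebra of $L$ over $K$, with $K$-basis $\{p_x^y \mid x\le y \text{ in } L\}$ and multiplication $p_x^y\,p_y^z=p_x^z$ and $p_x^y\,p_{w}^z=0$ for $y\neq w$. Let $C\subseteq L$ be a strong antichain, i.e. an antichain such that for all subsets $S,S'\subseteq C$, $\bigvee S\le\bigvee S'$ implies $S\subseteq S'$. Let $P(m)=p_m^mA$, let $N_C=\sum_{x\in C}p_m^xA\subseteq P(m)$, and let $M_C=P(m)/N_C$ be the antichain module of $C$, a right $A$-module. Then $M_C$ is perfect, i.e. $$\operatorname{grade} M_C:=\inf\{i\ge 0\mid \operatorname{Ext}_A^i(M_C,A)\neq 0\}=\operatorname{pdim} M_C,$$ if and only if $C$ is Boolean, i.e. $(\bigvee S)\wedge(\bigvee S')=\bigvee(S\cap S')$ for all subsets $S,S'\subseteq C$. -/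

import Mathlib

open CategoryTheory

universe u v

/-! ### Grade and perfect modules

A right `R`-module is a module over the opposite ring `Rᵐᵒᵖ`. -/

section Perfect

variable (R : Type u) [Ring R]

/-- The grade of a right `R`-module `M`, that is
`inf {i ≥ 0 | Ext_R^i(M, R) ≠ 0}`, with the value `⊤` if all these `Ext` groups vanish. Here `R` is
regarded as a right module over itself. -/
noncomputable def rightGrade (M : Type u) [AddCommGroup M] [Module Rᵐᵒᵖ M] : ℕ∞ :=
  sInf {n : ℕ∞ | ∃ i : ℕ, n = (i : ℕ∞) ∧
    Nontrivial (Abelian.Ext.{u} (ModuleCat.of Rᵐᵒᵖ M) (ModuleCat.of Rᵐᵒᵖ R) i)}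

/-- A right `R`-module is perfect if its grade equals its projective dimension (which lies in
`WithBot ℕ∞`, the value `⊥` being reserved for the zero module). -/
def IsPerfectRightModule (M : Type u) [AddCommGroup M] [Module Rᵐᵒᵖ M] : Prop :=
  (rightGrade R M : WithBot ℕ∞) = projectiveDimension (ModuleCat.of Rᵐᵒᵖ M)

end Perfect

/-! ### Strong and Boolean antichains -/

section Antichain

variable {L : Type v} [Lattice L] [BoundedOrder L]

/-- A strong antichain: an antichain `C` such that `⋁ S ≤ ⋁ S'` implies `S ⊆ S'` for all subsets
`S`, `S'` of `C`. The join of the empty set is the minimum of the lattice. -/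
def IsStrongLatticeAntichain (C : Finset L) : Prop :=
  IsAntichain (· ≤ ·) (C : Set L) ∧
    ∀ S S' : Finset L, S ⊆ C → S' ⊆ C → S.sup id ≤ S'.sup id → S ⊆ S'

/-- A Boolean antichain: an antichain `C` such that `(⋁ S) ∧ (⋁ S') = ⋁ (S ∩ S')` for all subsets
`S`, `S'` of `C`. -/
def IsBooleanLatticeAntichain [DecidableEq L] (C : Finset L) : Prop :=
  IsAntichain (· ≤ ·) (C : Set L) ∧
    ∀ S S' : Finset L, S ⊆ C → S' ⊆ C → S.sup id ⊓ S'.sup id = (S ∩ S').sup id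

end Antichain

/-! ### Antichain modules over the incidence algebra -/

namespace IncidenceAlgebra

section Path

variable (K : Type u) [Field K] {L : Type v} [PartialOrder L] [DecidableEq L]

/-- The basis element `p_x^y` of the incidence algebra, for `x ≤ y`: the class of the paths from
`x` to `y` in the Hasse diagram, i.e. the function with value `1` at `(x, y)` and `0` elsewhere. -/
def path (x y : L) (h : x ≤ y) : IncidenceAlgebra K L where
  toFun a b := if a = x ∧ b = y then 1 else 0
  eq_zero_of_not_le' a b hab := if_neg fun hxy => hab (by rw [hxy.1, hxy.2]; exact h)

/-- Concatenation of paths. -/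
theorem path_mul_path [LocallyFiniteOrder L] (x y z : L) (hxy : x ≤ y) (hyz : y ≤ z) :
    path K x y hxy * path K y z hyz = path K x z (hxy.trans hyz) := by
  ext a b hab
  by_cases h : a = x ∧ b = z
  · obtain ⟨rfl, rfl⟩ := h
    simp [path, mul_apply, hxy, hyz]
  · simp only [path, mul_apply, coe_mk, if_neg h]
    refine Finset.sum_eq_zero fun c _ => ?_
    by_cases ha : a = x
    · have hb : b ≠ z := fun hb => h ⟨ha, hb⟩
      simp [hb]
    · simp [ha]

end Path

section Module

variable (K : Type u) [Field K] {L : Type v} [Lattice L] [BoundedOrder L] [LocallyFiniteOrder L]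
  [DecidableEq L]

/-- The right ideal `P(x) = e_x A` of the incidence algebra `A` of `L`, where `e_x = p_x^x`. -/
def projRight (x : L) : Submodule (IncidenceAlgebra K L)ᵐᵒᵖ (IncidenceAlgebra K L) :=
  Submodule.span _ {path K x x le_rfl}

/-- The right ideal `N_C = ∑_{x ∈ C} p_m^x A`, where `m = ⊥` is the minimum of `L`. -/
def antichainIdeal (C : Finset L) :
    Submodule (IncidenceAlgebra K L)ᵐᵒᵖ (IncidenceAlgebra K L) :=
  ⨆ x ∈ C, Submodule.span _ {path K ⊥ x bot_le}

/-- `N_C` is contained in `P(m)`. -/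
theorem antichainIdeal_le (C : Finset L) : antichainIdeal K C ≤ projRight K (⊥ : L) := by
  refine iSup₂_le fun x _ => ?_
  rw [Submodule.span_singleton_le_iff_mem, projRight, Submodule.mem_span_singleton]
  exact ⟨MulOpposite.op (path K ⊥ x bot_le), path_mul_path K ⊥ ⊥ x le_rfl bot_le⟩

/-- The antichain module `M_C = P(m) / N_C`, a right module over the incidence algebra. -/
abbrev AntichainModule (C : Finset L) : Type (max u v) :=
  projRight K (⊥ : L) ⧸ (antichainIdeal K C).submoduleOf (projRight K ⊥)

end Module

end IncidenceAlgebra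

/-!
Write `P(b) = p_b^b A`, and let `M(b; C)` be the quotient of `P(b)` by the images of the modules
`P(b ⊔ x)`, `x ∈ C`, so that `M_C = M(⊥; C)`. Up to isomorphism, `P(b)` is the right ideal
`p_⊥^b A` of all elements in row `⊥` supported on the up-set of `b` (`rowIdeal`). In this form,
homomorphisms `P(b) → P(z)` are scalars, and there are non-zero ones exactly if `z ≤ b`.
The second isomorphism theorem gives short exact sequences
`0 → M(b ⊔ c; C) → M(b; C) → M(b; C ∪ {c}) → 0` (`relComplex_shortExact`). They replace the Koszul
type projective resolution of `M_C`, whose term in degree `i` is the sum of the `P(⋁ S)` for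
`S ⊆ C` with `|S| = i`: every statement about `Ext^i(M(b; C), P(z))` is proved by induction on
`C` with the long exact sequence. These groups depend only on the family `F` of those `S ⊆ C`
for which `z ≤ b ⊔ ⋁ S`:

* if `F` is empty, or a cone (membership of `S` in `F` does not depend on whether `c ∈ S`, for a fixed
  `c ∈ C`), they all vanish (`subsingleton_ext_of_forall_not_le`, `subsingleton_ext_insert`);
* if `F ⊆ {C}`, they vanish for `i < |C|`, and if `F = {C}`, the one for `i = |C|` is non-zero
  (`subsingleton_ext_of_lt_card`, `nontrivial_ext_card`);
* if `F` consists of the sets that strictly contain `D`, where `D ≠ C`, the one for `i = |D| + 1` is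
  non-zero (`nontrivial_ext_of_ssubset`).

The algebra `A` is the direct sum of the `P(z)`. For a strong antichain, `z = ⋁ C` has `F = {C}`,
so that `Ext^{|C|}(M_C, A) ≠ 0`. Hence the projective dimension is `|C|`, and `M_C` is perfect if and
only if `Ext^i(M_C, P(z)) = 0` for all `z` and all `i < |C|`. If `C` is Boolean, each `F` is closed under
intersections, so it is empty or consists of all supersets of a set `T`; thus it is empty, a cone
or `{C}`. Conversely, if these groups vanish, then `⋁ (C \ A)` is the meet `z` of the `⋁ (C \ {a})`,
`a ∈ A`: by the strong property, a minimal counterexample `A` would have `F` equal to the family of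
sets strictly containing `C \ A`, and `|A| ≥ 2`. This formula implies that `C` is Boolean.
-/

/-! ### Long exact sequences of `Ext` -/

section ExtLemmas

open Abelian

variable {𝒞 : Type*} [Category* 𝒞] [Abelian 𝒞] [HasExt.{u} 𝒞] {S : ShortComplex 𝒞}

theorem subsingleton_ext_of_shortExact (hS : S.ShortExact) (Y : 𝒞) (i : ℕ)
    (h₁ : ∀ j, j + 1 = i → Subsingleton (Ext.{u} S.X₁ Y j))
    (h₂ : Subsingleton (Ext.{u} S.X₂ Y i)) : Subsingleton (Ext.{u} S.X₃ Y i) := by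
  refine subsingleton_of_forall_eq 0 fun e => ?_
  have he : (Ext.mk₀ S.g).comp e (zero_add i) = 0 := Subsingleton.elim _ _
  cases i with
  | zero =>
    have := hS.epi_g
    exact Ext.precomp_mk₀_injective_of_epi Y S.g (a₁ := e) (a₂ := 0) (by simpa using he)
  | succ j =>
    obtain ⟨x, rfl⟩ := Ext.contravariant_sequence_exact₃ hS Y e he (add_comm 1 j)
    have := h₁ j rfl
    rw [Subsingleton.elim x 0, Ext.comp_zero]

theorem subsingleton_ext_zero_of_shortExact (hS : S.ShortExact) (Y : 𝒞)
    (h : ∀ φ : S.X₂ ⟶ Y, S.f ≫ φ = 0 → φ = 0) : Subsingleton (Ext.{u} S.X₃ Y 0) := by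
  refine Ext.homEquiv₀.subsingleton_congr.2 (subsingleton_of_forall_eq 0 fun φ => ?_)
  have := hS.epi_g
  rw [← cancel_epi S.g, Limits.comp_zero]
  exact h _ (by rw [← Category.assoc, S.zero, Limits.zero_comp])

theorem subsingleton_ext_one_of_shortExact (hS : S.ShortExact) [Projective S.X₂] (Y : 𝒞)
    (h : ∀ ψ : S.X₁ ⟶ Y, ∃ φ, S.f ≫ φ = ψ) : Subsingleton (Ext.{u} S.X₃ Y 1) := by
  refine subsingleton_of_forall_eq 0 fun e => ?_
  obtain ⟨x, rfl⟩ := Ext.contravariant_sequence_exact₃ hS Y e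
    (Ext.eq_zero_of_projective _) (n₀ := 0) rfl
  obtain ⟨ψ, rfl⟩ := (Ext.mk₀_bijective _ _).2 x
  obtain ⟨φ, rfl⟩ := h ψ
  rw [← Ext.mk₀_comp_mk₀, ShortComplex.ShortExact.extClass_comp_assoc]

theorem nontrivial_ext_succ_of_shortExact (hS : S.ShortExact) (Y : 𝒞) (i : ℕ)
    (h₁ : Nontrivial (Ext.{u} S.X₁ Y i)) (h₂ : Subsingleton (Ext.{u} S.X₂ Y i)) :
    Nontrivial (Ext.{u} S.X₃ Y (i + 1)) := by
  obtain ⟨x, hx⟩ := exists_ne (0 : Ext.{u} S.X₁ Y i)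
  refine ⟨hS.extClass.comp x (add_comm 1 i), 0, fun h => hx ?_⟩
  obtain ⟨y, rfl⟩ := Ext.contravariant_sequence_exact₁ hS Y x (add_comm 1 i) h
  rw [Subsingleton.elim y 0, Ext.comp_zero]

theorem nontrivial_ext_of_shortExact (hS : S.ShortExact) (Y : 𝒞) (i : ℕ)
    (h₁ : Subsingleton (Ext.{u} S.X₁ Y i)) (h₂ : Nontrivial (Ext.{u} S.X₂ Y i)) :
    Nontrivial (Ext.{u} S.X₃ Y i) := by
  obtain ⟨y, hy⟩ := exists_ne (0 : Ext.{u} S.X₂ Y i)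
  obtain ⟨x, rfl⟩ := Ext.contravariant_sequence_exact₂ hS Y y (Subsingleton.elim _ _)
  exact ⟨x, 0, fun h => hy (by rw [h, Ext.comp_zero])⟩

theorem subsingleton_ext_of_retract {X Y Z : 𝒞} (r : Retract Z Y) (i : ℕ)
    (h : Subsingleton (Ext.{u} X Y i)) : Subsingleton (Ext.{u} X Z i) := by
  refine subsingleton_of_forall_eq 0 fun e => ?_
  have h1 : (e.comp (Ext.mk₀ r.i) (add_zero i)).comp (Ext.mk₀ r.r) (add_zero i) = e := by
    rw [Ext.comp_assoc_of_second_deg_zero, Ext.mk₀_comp_mk₀, r.retract, Ext.comp_mk₀_id]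
  rw [← h1, Subsingleton.elim (e.comp _ _) 0, Ext.zero_comp]

/-- If the identity of `Y` is a sum of maps that factor through objects `Z j`, then `Ext` into `Y`
vanishes as soon as `Ext` into every `Z j` does. -/
theorem subsingleton_ext_of_sum_comp_eq_id {X Y : 𝒞} {ι : Type*} [Fintype ι] (Z : ι → 𝒞)
    (p : ∀ j, Y ⟶ Z j) (s : ∀ j, Z j ⟶ Y) (hps : ∑ j, p j ≫ s j = 𝟙 Y) (i : ℕ)
    (h : ∀ j, Subsingleton (Ext.{u} X (Z j) i)) : Subsingleton (Ext.{u} X Y i) := by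
  refine subsingleton_of_forall_eq 0 fun e => ?_
  rw [← Ext.comp_mk₀_id e, ← hps, Ext.mk₀_sum, Ext.comp_sum]
  refine Finset.sum_eq_zero fun j _ => ?_
  rw [← Ext.mk₀_comp_mk₀, ← Ext.comp_assoc_of_second_deg_zero,
    Subsingleton.elim (e.comp (Ext.mk₀ (p j)) (add_zero i)) 0, Ext.zero_comp]

end ExtLemmas

namespace IncidenceAlgebra

/-! ### Right ideals in the bottom row -/

section Path

variable (K : Type u) [Field K] {L : Type v} [PartialOrder L] [DecidableEq L]

theorem path_apply_self (x y : L) (h : x ≤ y) : path K x y h x y = 1 := by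
  simp [path]

theorem path_ne_zero (x y : L) (h : x ≤ y) : path K x y h ≠ 0 := fun h0 => by
  have := path_apply_self K x y h
  simp [h0] at this

variable [LocallyFiniteOrder L]

theorem path_mul_apply (x z : L) (h : x ≤ z) (f : IncidenceAlgebra K L) (a y : L) :
    (path K x z h * f) a y = if a = x then f z y else 0 := by
  simp only [mul_apply, path, coe_mk]
  split_ifs with ha
  · subst ha
    by_cases hzy : z ≤ y
    · rw [Finset.sum_eq_single z] <;> simp +contextual [h, hzy]
    · rw [apply_eq_zero_of_not_le hzy]
      refine Finset.sum_eq_zero fun w hw => ?_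
      have : w ≠ z := by rintro rfl; exact hzy (Finset.mem_Icc.1 hw).2
      simp [this]
  · simp [ha]

theorem mul_path_self_apply (f : IncidenceAlgebra K L) (z a y : L) :
    (f * path K z z le_rfl) a y = if y = z then f a y else 0 := by
  simp only [mul_apply, path, coe_mk]
  split_ifs with hy
  · subst hy
    by_cases hay : a ≤ y
    · rw [Finset.sum_eq_single y] <;> simp +contextual [hay]
    · rw [apply_eq_zero_of_not_le hay, Finset.Icc_eq_empty hay, Finset.sum_empty]
  · simp [hy]

end Path

section Rows

variable (K : Type u) [Field K] {L : Type v} [Lattice L] [BoundedOrder L] [LocallyFiniteOrder L]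
  [DecidableEq L]

/-- The right ideal `p_m^b A`, where `m = ⊥` is the minimum of `L`. It consists of the elements of
row `⊥` supported on the up-set of `b`, and is isomorphic to `P(b)`. -/
def rowIdeal (b : L) : Submodule (IncidenceAlgebra K L)ᵐᵒᵖ (IncidenceAlgebra K L) :=
  Submodule.span _ {path K ⊥ b bot_le}

open scoped Classical in
/-- The row `⊥` of `f`, moved to row `z` and cut off outside the up-set of `z`. -/
noncomputable def moveRow (z : L) (f : IncidenceAlgebra K L) : IncidenceAlgebra K L where
  toFun x y := if x = z ∧ z ≤ y then f ⊥ y else 0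
  eq_zero_of_not_le' _ _ h := if_neg fun hz => h (hz.1.trans_le hz.2)

variable {K} in
theorem mem_rowIdeal {b : L} {f : IncidenceAlgebra K L} :
    f ∈ rowIdeal K b ↔ ∀ x y, f x y ≠ 0 → x = ⊥ ∧ b ≤ y := by
  rw [rowIdeal, Submodule.mem_span_singleton]
  constructor
  · rintro ⟨a, rfl⟩ x y h
    rw [MulOpposite.smul_eq_mul_unop, path_mul_apply] at h
    split_ifs at h with hx
    · exact ⟨hx, le_of_ne_zero h⟩
    · exact absurd rfl h
  · intro h
    refine ⟨MulOpposite.op (moveRow K b f), ?_⟩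
    ext x y _
    rw [op_smul_eq_mul, path_mul_apply]
    by_cases hf : f x y = 0
    · rw [hf]
      split_ifs with hx
      · subst hx
        simp [moveRow, hf]
      · rfl
    · obtain ⟨rfl, hb⟩ := h x y hf
      simp [moveRow, hb]

variable {K} in
/-- `moveRow` undoes left multiplication by `p_⊥^b`. -/
theorem path_mul_moveRow {b : L} {f : IncidenceAlgebra K L} (hf : f ∈ rowIdeal K b) :
    path K ⊥ b bot_le * moveRow K b f = f := by
  rw [mem_rowIdeal] at hf
  ext x y _
  rw [path_mul_apply]
  by_cases h : f x y = 0
  · by_cases hx : x = ⊥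
    · subst hx
      simp [moveRow, h]
    · simp [hx, h]
  · obtain ⟨rfl, hb⟩ := hf x y h
    simp [moveRow, hb]

theorem path_mem_rowIdeal (b : L) : path K ⊥ b bot_le ∈ rowIdeal K b :=
  Submodule.mem_span_singleton_self _

theorem rowIdeal_anti {b c : L} (h : b ≤ c) : rowIdeal K c ≤ rowIdeal K b := fun _ hf =>
  mem_rowIdeal.2 fun x y hxy => ((mem_rowIdeal.1 hf) x y hxy).imp_right h.trans

theorem antichainIdeal_empty : antichainIdeal K (∅ : Finset L) = ⊥ := by
  simp [antichainIdeal]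

theorem antichainIdeal_insert (c : L) (C : Finset L) :
    antichainIdeal K (insert c C) = rowIdeal K c ⊔ antichainIdeal K C := by
  rw [antichainIdeal, Finset.iSup_insert]
  rfl

/-- The part of `f` in the columns of the up-set of `c`. -/
def truncate [DecidableLE L] (c : L) (f : IncidenceAlgebra K L) : IncidenceAlgebra K L where
  toFun x y := if c ≤ y then f x y else 0
  eq_zero_of_not_le' x y h := by rw [apply_eq_zero_of_not_le h, ite_self]

variable {K} in
theorem mem_antichainIdeal {C : Finset L} {f : IncidenceAlgebra K L} :
    f ∈ antichainIdeal K C ↔ ∀ x y, f x y ≠ 0 → x = ⊥ ∧ ∃ c ∈ C, c ≤ y := by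
  classical
  induction C using Finset.induction_on generalizing f with
  | empty =>
    rw [antichainIdeal_empty, Submodule.mem_bot]
    constructor
    · rintro rfl x y h
      exact absurd rfl h
    · intro h
      ext x y _
      by_contra hf
      simpa using h x y hf
  | insert c C _ ih =>
    rw [antichainIdeal_insert, Submodule.mem_sup]
    constructor
    · rintro ⟨g, hg, h, hh, rfl⟩ x y hxy
      by_cases hgx : g x y = 0
      · obtain ⟨hx, d, hd, hdy⟩ := ih.1 hh x y (by simpa [add_apply, hgx] using hxy)
        exact ⟨hx, d, Finset.mem_insert_of_mem hd, hdy⟩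
      · obtain ⟨hx, hcy⟩ := mem_rowIdeal.1 hg x y hgx
        exact ⟨hx, c, Finset.mem_insert_self _ _, hcy⟩
    · intro h
      refine ⟨truncate K c f, mem_rowIdeal.2 fun x y hxy => ?_, f - truncate K c f,
        ih.2 fun x y hxy => ?_, add_sub_cancel _ _⟩
      · by_cases hc : c ≤ y
        · exact ⟨(h x y (by simpa [truncate, hc] using hxy)).1, hc⟩
        · simp [truncate, hc] at hxy
      · by_cases hc : c ≤ y
        · simp [sub_apply, truncate, hc] at hxy
        · obtain ⟨hx, d, hd, hdy⟩ := h x y (by simpa [sub_apply, truncate, hc] using hxy)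
          obtain rfl | hd := Finset.mem_insert.1 hd
          · exact absurd hdy hc
          · exact ⟨hx, d, hd, hdy⟩

/-! ### Homomorphisms between the right ideals `p_⊥^b A` -/

variable {K} in
/-- Homomorphisms between the ideals `p_⊥^b A` are scalars. -/
theorem exists_smul_of_linearMap {b z : L}
    (φ : rowIdeal K b →ₗ[(IncidenceAlgebra K L)ᵐᵒᵖ] rowIdeal K z) :
    ∃ k : K, ∀ f, (φ f : IncidenceAlgebra K L) = k • (f : IncidenceAlgebra K L) := by
  set p : rowIdeal K b := ⟨path K ⊥ b bot_le, path_mem_rowIdeal K b⟩ with hp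
  have hpe : MulOpposite.op (path K b b le_rfl) • p = p :=
    Subtype.ext (path_mul_path K ⊥ b b bot_le le_rfl)
  set g : IncidenceAlgebra K L := ↑(φ p) with hg
  have hge : g * path K b b le_rfl = g := by
    conv_rhs => rw [hg, ← hpe, map_smul]
    rfl
  have hgp : g = g ⊥ b • path K ⊥ b bot_le := by
    ext x y _
    rw [constSMul_apply, smul_eq_mul]
    by_cases hxy : g x y = 0
    · by_cases h : x = ⊥ ∧ y = b
      · obtain ⟨rfl, rfl⟩ := h
        simp [hxy]
      · simp [path, h, hxy]
    · obtain ⟨rfl, -⟩ := mem_rowIdeal.1 (φ p).2 x y hxy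
      have : y = b := by
        by_contra hyb
        rw [← hge, mul_path_self_apply, if_neg hyb] at hxy
        exact hxy rfl
      subst this
      simp [path_apply_self]
  refine ⟨g ⊥ b, fun f => ?_⟩
  have hf : f = MulOpposite.op (moveRow K b (f : IncidenceAlgebra K L)) • p :=
    Subtype.ext (path_mul_moveRow f.2).symm
  have h1 : (φ f : IncidenceAlgebra K L) = g * moveRow K b (f : IncidenceAlgebra K L) := by
    conv_lhs => rw [hf, map_smul]
    rfl
  rw [h1, hgp, smul_mul_assoc, path_mul_moveRow f.2, ← hgp]

variable {K} in
theorem smul_mem_rowIdeal {b : L} (k : K) {f : IncidenceAlgebra K L} (hf : f ∈ rowIdeal K b) :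
    k • f ∈ rowIdeal K b :=
  mem_rowIdeal.2 fun x y h => mem_rowIdeal.1 hf x y fun h0 => h (by simp [constSMul_apply, h0])

/-- Multiplication by `k`, as a homomorphism `p_⊥^b A → p_⊥^z A`; it exists if `z ≤ b`, or `k = 0`. -/
def smulRow (b z : L) (k : K) (h : k ≠ 0 → z ≤ b) :
    rowIdeal K b →ₗ[(IncidenceAlgebra K L)ᵐᵒᵖ] rowIdeal K z where
  toFun f := ⟨k • (f : IncidenceAlgebra K L), by
    by_cases hk : k = 0
    · simp [hk]
    · exact rowIdeal_anti K (h hk) (smul_mem_rowIdeal k f.2)⟩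
  map_add' _ _ := Subtype.ext (smul_add _ _ _)
  map_smul' a f := Subtype.ext (smul_mul_assoc k (f : IncidenceAlgebra K L) a.unop).symm

variable {K} in
theorem le_of_smul_mem_rowIdeal {b z : L} {k : K} (hk : k ≠ 0)
    (h : k • path K ⊥ b bot_le ∈ rowIdeal K z) : z ≤ b :=
  (mem_rowIdeal.1 h ⊥ b (by simpa [constSMul_apply, path_apply_self] using hk)).2

/-! ### The ideals `p_⊥^z A` as direct summands of the algebra -/

/-- Left multiplication by `p_⊥^z`. -/
def rowProj (z : L) : IncidenceAlgebra K L →ₗ[(IncidenceAlgebra K L)ᵐᵒᵖ] rowIdeal K z where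
  toFun f := ⟨path K ⊥ z bot_le * f,
    Submodule.mem_span_singleton.2 ⟨MulOpposite.op f, rfl⟩⟩
  map_add' _ _ := Subtype.ext (mul_add _ _ _)
  map_smul' a f := Subtype.ext (mul_assoc _ f a.unop).symm

/-- The embedding of `p_⊥^z A` into the algebra as row `z`. -/
noncomputable def rowIncl (z : L) : rowIdeal K z →ₗ[(IncidenceAlgebra K L)ᵐᵒᵖ] IncidenceAlgebra K L where
  toFun f := moveRow K z f
  map_add' f g := by
    ext x y _
    by_cases h : x = z ∧ z ≤ y <;> simp [moveRow, add_apply, h]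
  map_smul' a f := by
    have hf : ∀ y, ¬ z ≤ y → (f : IncidenceAlgebra K L) ⊥ y = 0 := fun y hy => by
      by_contra h
      exact hy (mem_rowIdeal.1 f.2 ⊥ y h).2
    ext x y hxy
    change _ = (moveRow K z (f : IncidenceAlgebra K L) * a.unop) x y
    change (moveRow K z ((f : IncidenceAlgebra K L) * a.unop)) x y = _
    by_cases hx : x = z
    · subst hx
      simp only [moveRow, coe_mk, mul_apply, hxy, and_self, if_true]
      symm
      refine Finset.sum_subset_zero_on_sdiff (Finset.Icc_subset_Icc_left bot_le) (fun w hw => ?_)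
        fun w hw => ?_
      · simp only [Finset.mem_sdiff, Finset.mem_Icc, bot_le, true_and] at hw
        rw [hf w fun h => hw.2 ⟨h, hw.1⟩, zero_mul]
      · simp [(Finset.mem_Icc.1 hw).1]
    · simp [moveRow, hx]

theorem rowProj_comp_rowIncl (z : L) : rowProj K z ∘ₗ rowIncl K z = LinearMap.id :=
  LinearMap.ext fun f => Subtype.ext (path_mul_moveRow f.2)

theorem sum_rowIncl_comp_rowProj [Fintype L] :
    ∑ z : L, rowIncl K z ∘ₗ rowProj K z = LinearMap.id := by
  refine LinearMap.ext fun f => ?_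
  have key : ∀ (s : Finset L) (x y : L), (∑ z ∈ s, moveRow K z (path K ⊥ z bot_le * f)) x y =
      ∑ z ∈ s, moveRow K z (path K ⊥ z bot_le * f) x y := by
    intro s x y
    induction s using Finset.induction_on with
    | empty => simp
    | insert a s ha ih => rw [Finset.sum_insert ha, Finset.sum_insert ha, add_apply, ih]
  rw [LinearMap.sum_apply]
  ext x y hxy
  refine (key Finset.univ x y).trans ?_
  rw [Finset.sum_eq_single x]
  · simp only [moveRow, coe_mk, path_mul_apply, hxy, and_self, if_true]
    rfl
  · intro z _ hz
    simp [moveRow, hz.symm]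
  · simp

instance projective_self :
    Module.Projective (IncidenceAlgebra K L)ᵐᵒᵖ (IncidenceAlgebra K L) :=
  let e : (IncidenceAlgebra K L)ᵐᵒᵖ ≃ₗ[(IncidenceAlgebra K L)ᵐᵒᵖ] IncidenceAlgebra K L :=
    { toFun := MulOpposite.unop
      invFun := MulOpposite.op
      map_add' := fun _ _ => rfl
      map_smul' := fun _ _ => rfl
      left_inv := fun _ => rfl
      right_inv := fun _ => rfl }
  Module.Projective.of_equiv e

instance projective_rowIdeal (z : L) :
    Module.Projective (IncidenceAlgebra K L)ᵐᵒᵖ (rowIdeal K z) :=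
  Module.Projective.of_split (rowIncl K z) (rowProj K z) (rowProj_comp_rowIncl K z)

end Rows

open Abelian

section Modules

variable (K : Type u) [Field K] {L : Type v} [Lattice L] [BoundedOrder L] [LocallyFiniteOrder L]
  [DecidableEq L]

/-! ### Relative antichain modules -/

/-- The quotient of `p_⊥^b A ≅ P(b)` by its intersection with `N_C`, that is, the quotient of `P(b)`
by the images of the `P(b ⊔ x)` for `x ∈ C`, written `M(b; C)` in comments. For `b = ⊥` this is the
antichain module of `C`. -/
abbrev RelModule (b : L) (C : Finset L) : Type (max u v) :=
  rowIdeal K b ⧸ (antichainIdeal K C).submoduleOf (rowIdeal K b)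

/-- `RelModule` as an object of the category of right modules. -/
abbrev relModule (b : L) (C : Finset L) : ModuleCat.{max u v} (IncidenceAlgebra K L)ᵐᵒᵖ :=
  ModuleCat.of _ (RelModule K b C)

/-- `p_⊥^z A ≅ P(z)` as an object of the category of right modules. -/
abbrev rowModule (z : L) : ModuleCat.{max u v} (IncidenceAlgebra K L)ᵐᵒᵖ :=
  ModuleCat.of _ (rowIdeal K z)

theorem antichainIdeal_mono {C D : Finset L} (h : C ⊆ D) :
    antichainIdeal K C ≤ antichainIdeal K D := fun _ hf =>
  mem_antichainIdeal.2 fun x y hxy => (mem_antichainIdeal.1 hf x y hxy).imp_right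
    fun ⟨c, hc, hcy⟩ => ⟨c, h hc, hcy⟩

/-- The map `M(b ⊔ c; C) → M(b; C)` induced by the inclusion of `p_⊥^{b ⊔ c} A` into `p_⊥^b A`. -/
def relModuleIncl (b c : L) (C : Finset L) :
    RelModule K (b ⊔ c) C →ₗ[(IncidenceAlgebra K L)ᵐᵒᵖ] RelModule K b C :=
  Submodule.mapQ _ _ (Submodule.inclusion (rowIdeal_anti K le_sup_left)) fun _ h => h

/-- The projection `M(b; C) → M(b; C ∪ {c})`. -/
def relModuleProj (b c : L) (C : Finset L) :
    RelModule K b C →ₗ[(IncidenceAlgebra K L)ᵐᵒᵖ] RelModule K b (insert c C) :=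
  Submodule.factor fun _ h => antichainIdeal_mono K (Finset.subset_insert c C) h

theorem relModuleIncl_injective (b c : L) (C : Finset L) :
    Function.Injective (relModuleIncl K b c C) := by
  rw [injective_iff_map_eq_zero]
  intro x hx
  obtain ⟨f, rfl⟩ := Submodule.Quotient.mk_surjective _ x
  have hf : (f : IncidenceAlgebra K L) ∈ antichainIdeal K C :=
    (Submodule.Quotient.mk_eq_zero ((antichainIdeal K C).submoduleOf (rowIdeal K b))).1 hx
  exact (Submodule.Quotient.mk_eq_zero _).2 hf

theorem relModuleProj_surjective (b c : L) (C : Finset L) :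
    Function.Surjective (relModuleProj K b c C) := fun x => by
  obtain ⟨f, rfl⟩ := Submodule.Quotient.mk_surjective _ x
  exact ⟨Submodule.Quotient.mk f, rfl⟩

theorem relModule_exact (b c : L) (C : Finset L) :
    Function.Exact (relModuleIncl K b c C) (relModuleProj K b c C) := by
  classical
  intro x
  obtain ⟨f, rfl⟩ := Submodule.Quotient.mk_surjective _ x
  constructor
  · intro hx
    have hf : (f : IncidenceAlgebra K L) ∈ antichainIdeal K (insert c C) :=
      (Submodule.Quotient.mk_eq_zero
        ((antichainIdeal K (insert c C)).submoduleOf (rowIdeal K b))).1 hx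
    have hb := mem_rowIdeal.1 f.2
    rw [mem_antichainIdeal] at hf
    have hg : truncate K c (f : IncidenceAlgebra K L) ∈ rowIdeal K (b ⊔ c) := by
      refine mem_rowIdeal.2 fun x y hxy => ?_
      by_cases hc : c ≤ y
      · obtain ⟨h1, h2⟩ := hb x y (by simpa [truncate, hc] using hxy)
        exact ⟨h1, sup_le h2 hc⟩
      · simp [truncate, hc] at hxy
    refine ⟨Submodule.Quotient.mk ⟨_, hg⟩, ?_⟩
    refine ((Submodule.Quotient.eq _).2 ?_).symm
    change (f : IncidenceAlgebra K L) - truncate K c (f : IncidenceAlgebra K L) ∈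
      antichainIdeal K C
    refine mem_antichainIdeal.2 fun x y hxy => ?_
    by_cases hc : c ≤ y
    · simp [sub_apply, truncate, hc] at hxy
    · obtain ⟨h1, d, hd, hdy⟩ := hf x y (by simpa [sub_apply, truncate, hc] using hxy)
      obtain rfl | hd := Finset.mem_insert.1 hd
      · exact absurd hdy hc
      · exact ⟨h1, d, hd, hdy⟩
  · rintro ⟨y, hy⟩
    obtain ⟨g, rfl⟩ := Submodule.Quotient.mk_surjective _ y
    rw [← hy]
    refine (Submodule.Quotient.mk_eq_zero _).2 ?_
    change (g : IncidenceAlgebra K L) ∈ antichainIdeal K (insert c C)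
    refine mem_antichainIdeal.2 fun x y hxy => ?_
    obtain ⟨h1, h2⟩ := mem_rowIdeal.1 g.2 x y hxy
    exact ⟨h1, c, Finset.mem_insert_self _ _, le_sup_right.trans h2⟩

/-- The sequence `0 → M(b ⊔ c; C) → M(b; C) → M(b; C ∪ {c}) → 0` of relative antichain modules. -/
abbrev relComplex (b c : L) (C : Finset L) :
    ShortComplex (ModuleCat.{max u v} (IncidenceAlgebra K L)ᵐᵒᵖ) :=
  ShortComplex.mk (X₁ := relModule K (b ⊔ c) C) (X₂ := relModule K b C)
    (X₃ := relModule K b (insert c C))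
    (ModuleCat.ofHom (relModuleIncl K b c C)) (ModuleCat.ofHom (relModuleProj K b c C)) (by
      ext x
      exact (relModule_exact K b c C _).2 ⟨Submodule.Quotient.mk x, rfl⟩)

theorem relComplex_shortExact (b c : L) (C : Finset L) : (relComplex K b c C).ShortExact where
  exact := (ShortComplex.ShortExact.moduleCat_exact_iff_function_exact _).2 (relModule_exact K b c C)
  mono_f := (ModuleCat.mono_iff_injective _).2 (relModuleIncl_injective K b c C)
  epi_g := (ModuleCat.epi_iff_surjective _).2 (relModuleProj_surjective K b c C)

theorem submoduleOf_antichainIdeal_empty (b : L) :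
    (antichainIdeal K (∅ : Finset L)).submoduleOf (rowIdeal K b) = ⊥ := by
  rw [antichainIdeal_empty, Submodule.submoduleOf, Submodule.comap_bot, Submodule.ker_subtype]

instance projective_relModule_empty (b : L) : Projective (relModule K b ∅) :=
  have : Module.Projective (IncidenceAlgebra K L)ᵐᵒᵖ (RelModule K b ∅) :=
    Module.Projective.of_equiv
      (Submodule.quotEquivOfEqBot _ (submoduleOf_antichainIdeal_empty K b)).symm
  inferInstance

theorem hasProjectiveDimensionLT_relModule (b : L) (C : Finset L) :
    HasProjectiveDimensionLT (relModule K b C) (C.card + 1) := by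
  induction C using Finset.induction_on generalizing b with
  | empty => exact projective_iff_hasProjectiveDimensionLT_one.1 inferInstance
  | insert c C hc ih =>
    rw [Finset.card_insert_of_notMem hc]
    have := ih b
    exact (relComplex_shortExact K b c C).hasProjectiveDimensionLT_X₃ _ (ih (b ⊔ c))
      (hasProjectiveDimensionLT_of_ge (relModule K b C) (C.card + 1) _ (by lia))

/-! ### Vanishing and non-vanishing of `Ext` -/

variable {K}

theorem exists_smul_of_hom {b z : L} (φ : relModule K b ∅ ⟶ rowModule K z) :
    ∃ k : K, ∀ f : rowIdeal K b, (φ.hom (Submodule.Quotient.mk f) : IncidenceAlgebra K L) =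
      k • (f : IncidenceAlgebra K L) :=
  exists_smul_of_linearMap (φ.hom ∘ₗ Submodule.mkQ _)

variable (K) in
/-- Multiplication by `k` as a morphism `P(b) ⟶ P(z)`. -/
def smulHom (b z : L) (k : K) (h : k ≠ 0 → z ≤ b) : relModule K b ∅ ⟶ rowModule K z :=
  ModuleCat.ofHom (Submodule.liftQ _ (smulRow K b z k h)
    (by rw [submoduleOf_antichainIdeal_empty]; exact bot_le))

theorem le_of_exists_smul {b z : L} {φ : relModule K b ∅ ⟶ rowModule K z} {k : K}
    (hk : ∀ f : rowIdeal K b, (φ.hom (Submodule.Quotient.mk f) : IncidenceAlgebra K L) =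
      k • (f : IncidenceAlgebra K L)) (h : k ≠ 0) : z ≤ b :=
  le_of_smul_mem_rowIdeal h (hk ⟨_, path_mem_rowIdeal K b⟩ ▸ (φ.hom _).2)

theorem hom_eq_smulHom {b z : L} (φ : relModule K b ∅ ⟶ rowModule K z) {k : K}
    (hk : ∀ f : rowIdeal K b, (φ.hom (Submodule.Quotient.mk f) : IncidenceAlgebra K L) =
      k • (f : IncidenceAlgebra K L)) : φ = smulHom K b z k (le_of_exists_smul hk) :=
  ModuleCat.hom_ext (Submodule.linearMap_qext _ (LinearMap.ext fun x => Subtype.ext (hk x)))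

theorem smulHom_zero (b z : L) (h) : smulHom K b z 0 h = 0 :=
  ModuleCat.hom_ext (Submodule.linearMap_qext _ (LinearMap.ext fun x =>
    Subtype.ext (zero_smul K (x : IncidenceAlgebra K L))))

theorem smulHom_one_ne_zero {b z : L} (h : z ≤ b) : smulHom K b z 1 (fun _ => h) ≠ 0 := by
  intro h0
  have := congrArg (fun φ => (φ.hom (Submodule.Quotient.mk ⟨_, path_mem_rowIdeal K b⟩) :
    IncidenceAlgebra K L)) h0
  exact path_ne_zero K ⊥ b bot_le ((one_smul K _).symm.trans this)

/-- `Ext^i(P(b), P(z))` vanishes unless `i = 0` and `z ≤ b`. -/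
theorem subsingleton_ext_relModule_empty {b z : L} (i : ℕ) (h : i = 0 → ¬ z ≤ b) :
    Subsingleton (Ext.{max u v} (relModule K b ∅) (rowModule K z) i) := by
  cases i with
  | zero =>
    refine (Ext.homEquiv₀ (X := relModule K b ∅) (Y := rowModule K z)).subsingleton_congr.2
      (subsingleton_of_forall_eq 0 fun φ => ?_)
    obtain ⟨k, hk⟩ := exists_smul_of_hom φ
    have : k = 0 := by
      by_contra hk0
      exact h rfl (le_of_exists_smul hk hk0)
    subst this
    rw [hom_eq_smulHom φ hk, smulHom_zero]
  | succ j => exact subsingleton_of_forall_eq 0 fun e => e.eq_zero_of_projective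

theorem nontrivial_ext_relModule_empty {b z : L} (h : z ≤ b) :
    Nontrivial (Ext.{max u v} (relModule K b ∅) (rowModule K z) 0) :=
  (Ext.homEquiv₀ (X := relModule K b ∅) (Y := rowModule K z)).nontrivial_congr.2
    ⟨_, _, smulHom_one_ne_zero h⟩

/-- If `z` lies below no `b ⊔ ⋁ S` with `S ⊆ C`, then none of the modules `P(b ⊔ ⋁ S)` out of which
`M(b; C)` is built has a non-zero homomorphism to `P(z)`. -/
theorem subsingleton_ext_of_forall_not_le {z : L} (C : Finset L) (b : L)
    (h : ∀ S ⊆ C, ¬ z ≤ b ⊔ S.sup id) (i : ℕ) :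
    Subsingleton (Ext.{max u v} (relModule K b C) (rowModule K z) i) := by
  induction C using Finset.induction_on generalizing b i with
  | empty =>
    exact subsingleton_ext_relModule_empty i fun _ => by simpa using h ∅ (Finset.empty_subset _)
  | insert c C _ ih =>
    refine subsingleton_ext_of_shortExact (relComplex_shortExact K b c C) _ i (fun j _ => ?_) ?_
    · refine ih (b ⊔ c) (fun S hS => ?_) j
      simpa [sup_assoc] using h (insert c S) (Finset.insert_subset_insert c hS)
    · exact ih b (fun S hS => h S (hS.trans (Finset.subset_insert c C))) i

/-- The case of a single element: the restriction map from `Hom(P(b), P(z))` to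
`Hom(P(b ⊔ c), P(z))` is bijective if `z ≤ b ⊔ c` implies `z ≤ b`. -/
theorem subsingleton_ext_singleton {b c z : L} (h : z ≤ b ⊔ c → z ≤ b) (i : ℕ) :
    Subsingleton (Ext.{max u v} (relModule K b {c}) (rowModule K z) i) := by
  have hS := relComplex_shortExact K b c ∅
  have hr : ∀ k hk hk',
      (relComplex K b c ∅).f ≫ smulHom K b z k hk = smulHom K (b ⊔ c) z k hk' := by
    intro k hk hk'
    ext x
    rfl
  match i with
  | 0 =>
    refine subsingleton_ext_zero_of_shortExact hS _ fun φ h0 => ?_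
    obtain ⟨k, hk⟩ := exists_smul_of_hom φ
    have hk0 : k = 0 := by
      by_contra hk0
      have h1 := congrArg (fun φ => (φ.hom (Submodule.Quotient.mk
        ⟨_, path_mem_rowIdeal K (b ⊔ c)⟩) : IncidenceAlgebra K L)) h0
      refine smul_ne_zero hk0 (path_ne_zero K ⊥ (b ⊔ c) bot_le) (Eq.trans ?_ h1)
      exact (hk ⟨_, rowIdeal_anti K le_sup_left (path_mem_rowIdeal K (b ⊔ c))⟩).symm
    subst hk0
    rw [hom_eq_smulHom φ hk, smulHom_zero]
  | 1 =>
    have : Projective (relComplex K b c ∅).X₂ := projective_relModule_empty K b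
    refine subsingleton_ext_one_of_shortExact hS _ fun ψ => ?_
    obtain ⟨k, hk⟩ := exists_smul_of_hom ψ
    refine ⟨smulHom K b z k fun hk0 => h (le_of_exists_smul hk hk0), ?_⟩
    rw [hr k _ (le_of_exists_smul hk)]
    exact (hom_eq_smulHom ψ hk).symm
  | j + 2 =>
    refine subsingleton_ext_of_shortExact hS _ _ (fun l hl => ?_) ?_
    · exact subsingleton_ext_relModule_empty l (by lia)
    · exact subsingleton_ext_relModule_empty _ (by lia)

/-- If adding `c` to `S ⊆ C` never makes a difference to `z ≤ b ⊔ ⋁ S`, then all `Ext` groups vanish: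
the family of these `S` is a cone with apex `c`. -/
theorem subsingleton_ext_insert {z c : L} (C : Finset L) (b : L)
    (h : ∀ S ⊆ C, z ≤ b ⊔ c ⊔ S.sup id → z ≤ b ⊔ S.sup id) (i : ℕ) :
    Subsingleton (Ext.{max u v} (relModule K b (insert c C)) (rowModule K z) i) := by
  induction C using Finset.induction_on generalizing b i with
  | empty => exact subsingleton_ext_singleton (by simpa using h ∅ (Finset.empty_subset _)) i
  | insert d C _ ih =>
    rw [Finset.insert_comm]
    refine subsingleton_ext_of_shortExact (relComplex_shortExact K b d (insert c C)) _ i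
      (fun j _ => ?_) ?_
    · refine ih (b ⊔ d) (fun S hS hz => ?_) j
      have := h (insert d S) (Finset.insert_subset_insert d hS)
        (by simpa [sup_assoc, sup_left_comm] using hz)
      simpa [sup_assoc] using this
    · exact ih b (fun S hS => h S (hS.trans (Finset.subset_insert d C))) i

/-- If `z ≤ b ⊔ ⋁ S` holds at most for `S = C`, then `Ext` vanishes below degree `|C|`. -/
theorem subsingleton_ext_of_lt_card {z : L} (C : Finset L) (b : L)
    (h : ∀ S ⊆ C, z ≤ b ⊔ S.sup id → S = C) (i : ℕ) (hi : i < C.card) :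
    Subsingleton (Ext.{max u v} (relModule K b C) (rowModule K z) i) := by
  induction C using Finset.induction_on generalizing b i with
  | empty => simp at hi
  | insert c C hc ih =>
    rw [Finset.card_insert_of_notMem hc] at hi
    refine subsingleton_ext_of_shortExact (relComplex_shortExact K b c C) _ i (fun j hj => ?_) ?_
    · refine ih (b ⊔ c) (fun S hS hz => ?_) j (by lia)
      have := h (insert c S) (Finset.insert_subset_insert c hS) (by simpa [sup_assoc] using hz)
      rw [← Finset.erase_insert (fun hcS => hc (hS hcS)), this, Finset.erase_insert hc]
    · refine subsingleton_ext_of_forall_not_le C b (fun S hS hz => ?_) i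
      have := h S (hS.trans (Finset.subset_insert c C)) hz
      exact hc (hS (this ▸ Finset.mem_insert_self c C))

/-- If `z ≤ b ⊔ ⋁ S` holds for `S = C` and for no other `S ⊆ C`, then `Ext` is non-zero in degree
`|C|`. -/
theorem nontrivial_ext_card {z : L} (C : Finset L) (b : L)
    (h : ∀ S ⊆ C, z ≤ b ⊔ S.sup id ↔ S = C) :
    Nontrivial (Ext.{max u v} (relModule K b C) (rowModule K z) C.card) := by
  induction C using Finset.induction_on generalizing b with
  | empty =>
    exact nontrivial_ext_relModule_empty (by simpa using h ∅ (Finset.empty_subset _))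
  | insert c C hc ih =>
    rw [Finset.card_insert_of_notMem hc]
    refine nontrivial_ext_succ_of_shortExact (relComplex_shortExact K b c C) _ _
      (ih (b ⊔ c) fun S hS => ?_) ?_
    · have hcS : c ∉ S := fun hcS => hc (hS hcS)
      have := h (insert c S) (Finset.insert_subset_insert c hS)
      rw [Finset.sup_insert, id_eq, ← sup_assoc] at this
      rw [this]
      constructor
      · intro h'
        rw [← Finset.erase_insert hcS, h', Finset.erase_insert hc]
      · rintro rfl
        rfl
    · refine subsingleton_ext_of_forall_not_le C b (fun S hS hz => ?_) _
      have := (h S (hS.trans (Finset.subset_insert c C))).1 hz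
      exact hc (hS (this ▸ Finset.mem_insert_self c C))

/-- If `z ≤ b ⊔ ⋁ S` holds exactly for the `S` strictly containing `D`, where `C = D ∪ A`, then `Ext`
is non-zero in degree `|D| + 1`. The complements of these `S` are the proper subsets of `A`; they form
the boundary of a simplex, that is, a sphere, whose top homology accounts for the class. -/
theorem nontrivial_ext_of_ssubset {z : L} (D A : Finset L) (hA : A.Nonempty) (b : L)
    (hDA : Disjoint D A) (h : ∀ S ⊆ D ∪ A, z ≤ b ⊔ S.sup id ↔ D ⊂ S) :
    Nontrivial (Ext.{max u v} (relModule K b (D ∪ A)) (rowModule K z) (D.card + 1)) := by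
  induction hA using Finset.Nonempty.cons_induction with
  | singleton a =>
    have ha : a ∉ D := by simpa using hDA
    have hD : D ∪ {a} = insert a D := by rw [Finset.union_comm]; rfl
    rw [hD] at h ⊢
    rw [← Finset.card_insert_of_notMem ha]
    refine nontrivial_ext_card _ b fun S hS => (h S hS).trans ⟨fun hDS => ?_, fun hSD => ?_⟩
    · refine Finset.eq_of_subset_of_card_le hS ?_
      rw [Finset.card_insert_of_notMem ha]
      exact Finset.card_lt_card hDS
    · rw [hSD]
      exact Finset.ssubset_insert ha
  | cons a A ha hA ih =>
    rw [Finset.cons_eq_insert, Finset.union_insert] at h ⊢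
    rw [Finset.cons_eq_insert, Finset.disjoint_insert_right] at hDA
    refine nontrivial_ext_of_shortExact (relComplex_shortExact K b a (D ∪ A)) _ _ ?_
      (ih hDA.2 fun S hS => h S (hS.trans (Finset.subset_insert _ _)))
    -- Enlarging the base point by `a` turns the condition `D ⊂ S` into `D ⊆ S`, which does not
    -- depend on the elements of `A`.
    obtain ⟨a', ha'⟩ := hA
    have ha'D : a' ∉ D := fun hD => Finset.disjoint_left.1 hDA.2 hD ha'
    have hmem : a' ∈ D ∪ A := Finset.mem_union_right _ ha'
    change Subsingleton (Ext.{max u v} (relModule K (b ⊔ a) (D ∪ A)) (rowModule K z) (D.card + 1))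
    rw [← Finset.insert_erase hmem]
    refine subsingleton_ext_insert _ _ (fun S hS hz => ?_) _
    have hS' : S ⊆ D ∪ A := hS.trans (Finset.erase_subset _ _)
    have h1 := (h (insert a (insert a' S)) (Finset.insert_subset_insert a
      (Finset.insert_subset hmem hS'))).1 (by simpa [sup_assoc] using hz)
    have hDS : D ⊆ S := fun x hx => by
      have := h1.1 hx
      rw [Finset.mem_insert, Finset.mem_insert] at this
      rcases this with rfl | rfl | hxS
      · exact absurd hx hDA.1
      · exact absurd hx ha'D
      · exact hxS
    have h2 := (h (insert a S) (Finset.insert_subset_insert a hS')).2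
      ((hDS.trans (Finset.subset_insert _ _)).ssubset_of_ne
        fun hD => hDA.1 (hD ▸ Finset.mem_insert_self a S))
    simpa [sup_assoc] using h2

end Modules

section Perfect

variable (K : Type u) [Field K] {L : Type v} [Lattice L] [BoundedOrder L] [LocallyFiniteOrder L]
  [DecidableEq L]

/-! ### Passage from the modules `P(z)` to the algebra -/

theorem subsingleton_ext_self [Finite L]
    (X : ModuleCat.{max u v} (IncidenceAlgebra K L)ᵐᵒᵖ) (i : ℕ)
    (h : ∀ z : L, Subsingleton (Ext.{max u v} X (rowModule K z) i)) :
    Subsingleton (Ext.{max u v} X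
      (ModuleCat.of (IncidenceAlgebra K L)ᵐᵒᵖ (IncidenceAlgebra K L)) i) := by
  have := Fintype.ofFinite L
  refine subsingleton_ext_of_sum_comp_eq_id (fun z : L => rowModule K z)
    (fun z => ModuleCat.ofHom (rowProj K z)) (fun z => ModuleCat.ofHom (rowIncl K z)) ?_ i h
  refine ModuleCat.hom_ext ?_
  rw [ModuleCat.hom_sum]
  exact sum_rowIncl_comp_rowProj K

theorem subsingleton_ext_rowModule (X : ModuleCat.{max u v} (IncidenceAlgebra K L)ᵐᵒᵖ) (i : ℕ)
    (h : Subsingleton (Ext.{max u v} X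
      (ModuleCat.of (IncidenceAlgebra K L)ᵐᵒᵖ (IncidenceAlgebra K L)) i)) (z : L) :
    Subsingleton (Ext.{max u v} X (rowModule K z) i) :=
  subsingleton_ext_of_retract
    { i := ModuleCat.ofHom (rowIncl K z)
      r := ModuleCat.ofHom (rowProj K z)
      retract := ModuleCat.hom_ext (rowProj_comp_rowIncl K z) } i h

/-! ### Grade and projective dimension of the antichain module -/

variable {K} {C : Finset L}

/-- As `C` is strong, `⋁ C ≤ ⋁ S` holds for `S = C` only, so that `nontrivial_ext_card` applies with
`z = ⋁ C`. -/
theorem nontrivial_ext_self_card (hC : IsStrongLatticeAntichain C) :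
    Nontrivial (Ext.{max u v} (relModule K ⊥ C)
      (ModuleCat.of (IncidenceAlgebra K L)ᵐᵒᵖ (IncidenceAlgebra K L)) C.card) := by
  have := nontrivial_ext_card (K := K) (z := C.sup id) C ⊥ fun S hS => by
    rw [bot_sup_eq]
    exact ⟨fun h => hS.antisymm (hC.2 C S subset_rfl hS h), fun h => h ▸ le_rfl⟩
  by_contra h
  rw [not_nontrivial_iff_subsingleton] at h
  exact not_subsingleton_iff_nontrivial.2 this (subsingleton_ext_rowModule K _ _ h _)

theorem projectiveDimension_relModule (hC : IsStrongLatticeAntichain C) :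
    projectiveDimension (relModule K ⊥ C) = C.card := by
  refine le_antisymm ((projectiveDimension_le_iff _ _).2
    (hasProjectiveDimensionLT_relModule K ⊥ C)) ((projectiveDimension_ge_iff _ _).2 fun h => ?_)
  exact not_subsingleton_iff_nontrivial.2 (nontrivial_ext_self_card (K := K) hC)
    (HasProjectiveDimensionLT.subsingleton.{max u v} (relModule K ⊥ C) C.card C.card le_rfl _)

/-- The projective dimension of `M_C` equals `|C|` and its grade is at most `|C|`, so only the vanishing
of `Ext` below degree `|C|` is at stake. -/
theorem isPerfectRightModule_iff_forall_lt_card (hC : IsStrongLatticeAntichain C) :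
    IsPerfectRightModule (IncidenceAlgebra K L) (AntichainModule K C) ↔
      ∀ i < C.card, Subsingleton (Ext.{max u v} (relModule K ⊥ C)
        (ModuleCat.of (IncidenceAlgebra K L)ᵐᵒᵖ (IncidenceAlgebra K L)) i) := by
  have hpd : projectiveDimension (ModuleCat.of (IncidenceAlgebra K L)ᵐᵒᵖ (AntichainModule K C)) =
    ((C.card : ℕ∞) : WithBot ℕ∞) := projectiveDimension_relModule hC
  rw [IsPerfectRightModule, hpd, WithBot.coe_inj]
  constructor
  · intro h i hi
    rw [← not_nontrivial_iff_subsingleton]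
    intro hn
    have : rightGrade (IncidenceAlgebra K L) (AntichainModule K C) ≤ i := sInf_le ⟨i, rfl, hn⟩
    rw [h, Nat.cast_le] at this
    lia
  · intro h
    refine le_antisymm (sInf_le ⟨_, rfl, nontrivial_ext_self_card hC⟩) (le_sInf ?_)
    rintro _ ⟨i, rfl, hn⟩
    rw [Nat.cast_le]
    by_contra! hi
    exact not_nontrivial_iff_subsingleton.2 (h i hi) hn

/-! ### Boolean antichains -/

/-- If the hypothesis of `subsingleton_ext_insert` fails for every `c ∈ C`, then the Boolean property
shows that `z ≤ ⋁ S` holds at most for `S = C`. -/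
theorem subsingleton_ext_of_isBoolean (hB : IsBooleanLatticeAntichain C) (z : L) (i : ℕ)
    (hi : i < C.card) :
    Subsingleton (Ext.{max u v} (relModule K ⊥ C) (rowModule K z) i) := by
  by_cases h : ∃ c ∈ C, ∀ S ⊆ C.erase c, z ≤ c ⊔ S.sup id → z ≤ S.sup id
  · obtain ⟨c, hc, hcS⟩ := h
    rw [← Finset.insert_erase hc]
    refine subsingleton_ext_insert _ _ (fun S hS => ?_) i
    simpa using hcS S hS
  · push Not at h
    refine subsingleton_ext_of_lt_card C ⊥ (fun S hS hz => ?_) i hi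
    by_contra hne
    obtain ⟨c, hc, hcS⟩ : ∃ c ∈ C, c ∉ S := by
      by_contra! hCS
      exact hne (hS.antisymm hCS)
    obtain ⟨T, hT, hzT, hzT'⟩ := h c hc
    refine hzT' ?_
    rw [bot_sup_eq] at hz
    have hT' : T ⊆ C := hT.trans (Finset.erase_subset c C)
    have h1 := hB.2 S (insert c T) hS (Finset.insert_subset hc hT')
    rw [Finset.inter_insert_of_notMem hcS, Finset.sup_insert, id_eq] at h1
    exact (le_inf hz hzT).trans (h1.le.trans (Finset.sup_mono Finset.inter_subset_right))

/-- Vanishing of `Ext` below `|C|` forces `⋁ (C \ A)` to be the meet of the `⋁ (C \ {a})` for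
`a ∈ A` (and of `⋁ C`, which only matters for `A = ∅`). For a minimal counterexample `A`, the
sets `S` with `⋁ S` above that meet `z` are exactly those that strictly contain `C \ A`, and then
`nontrivial_ext_of_ssubset` yields a non-zero `Ext` group in degree `|C| - |A| + 1 < |C|`. -/
theorem inf_sup_erase_le_of_forall_ext (hC : IsStrongLatticeAntichain C)
    (h : ∀ (z : L), ∀ i < C.card,
      Subsingleton (Ext.{max u v} (relModule K ⊥ C) (rowModule K z) i))
    (A : Finset L) (hA : A ⊆ C) :
    C.sup id ⊓ A.inf (fun a => (C.erase a).sup id) ≤ (C \ A).sup id := by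
  induction A using Finset.strongInduction with
  | H A ih =>
    set z := C.sup id ⊓ A.inf (fun a => (C.erase a).sup id) with hz
    by_contra hzA
    have hA0 : A.Nonempty := by
      rw [Finset.nonempty_iff_ne_empty]
      rintro rfl
      simp [hz] at hzA
    have hA1 : 1 < A.card := by
      by_contra! hle
      obtain ⟨a, rfl⟩ := Finset.card_eq_one.1 (le_antisymm hle hA0.card_pos)
      refine hzA (hz.trans_le ?_)
      rw [Finset.inf_singleton, Finset.sdiff_singleton_eq_erase]
      exact inf_le_right
    have hU : C \ A ∪ A = C := Finset.sdiff_union_of_subset hA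
    have hnt := nontrivial_ext_of_ssubset (K := K) (z := z) (C \ A) A hA0 ⊥
      Finset.sdiff_disjoint fun S hS => by
        rw [hU] at hS
        rw [bot_sup_eq]
        constructor
        · intro hzS
          have hsub : C \ A ⊆ S := fun x hx => by
            obtain ⟨hxC, hxA⟩ := Finset.mem_sdiff.1 hx
            have hxz : x ≤ z := by
              refine le_inf (Finset.le_sup (f := id) hxC) (Finset.le_inf fun a ha => ?_)
              exact Finset.le_sup (f := id)
                (Finset.mem_erase.2 ⟨fun hxa => hxA (hxa ▸ ha), hxC⟩)
            have := hC.2 {x} S (Finset.singleton_subset_iff.2 hxC) hS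
              (by simpa using hxz.trans hzS)
            exact this (Finset.mem_singleton_self x)
          exact hsub.ssubset_of_ne fun he => hzA (he ▸ hzS)
        · intro hDS
          have hB : C \ S ⊂ A := by
            refine Finset.ssubset_iff_subset_ne.2 ⟨?_, fun he => ?_⟩
            · intro x hx
              obtain ⟨hxC, hxS⟩ := Finset.mem_sdiff.1 hx
              by_contra hxA
              exact hxS (hDS.1 (Finset.mem_sdiff.2 ⟨hxC, hxA⟩))
            · rw [← he, Finset.sdiff_sdiff_eq_self hS] at hDS
              exact hDS.ne rfl
          have := ih _ hB Finset.sdiff_subset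
          rw [Finset.sdiff_sdiff_eq_self hS] at this
          exact (inf_le_inf_left _ (Finset.inf_mono hB.1)).trans this
    rw [hU] at hnt
    refine not_subsingleton_iff_nontrivial.2 hnt (h z _ ?_)
    have := Finset.card_sdiff_add_card_eq_card hA
    lia

theorem isBoolean_of_forall_ext (hC : IsStrongLatticeAntichain C)
    (h : ∀ (z : L), ∀ i < C.card,
      Subsingleton (Ext.{max u v} (relModule K ⊥ C) (rowModule K z) i)) :
    IsBooleanLatticeAntichain C := by
  refine ⟨hC.1, fun S S' hS hS' => le_antisymm ?_ (le_inf
    (Finset.sup_mono Finset.inter_subset_left) (Finset.sup_mono Finset.inter_subset_right))⟩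
  have := inf_sup_erase_le_of_forall_ext hC h (C \ (S ∩ S')) Finset.sdiff_subset
  rw [Finset.sdiff_sdiff_eq_self (Finset.inter_subset_left.trans hS)] at this
  refine le_trans (le_inf (inf_le_left.trans (Finset.sup_mono hS)) (Finset.le_inf fun a ha => ?_))
    this
  obtain ⟨-, ha⟩ := Finset.mem_sdiff.1 ha
  by_cases haS : a ∈ S
  · have haS' : a ∉ S' := fun h' => ha (Finset.mem_inter.2 ⟨haS, h'⟩)
    exact inf_le_right.trans (Finset.sup_mono (Finset.subset_erase.2 ⟨hS', haS'⟩))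
  · exact inf_le_left.trans (Finset.sup_mono (Finset.subset_erase.2 ⟨hS, haS⟩))

end Perfect

end IncidenceAlgebra

theorem proposition4p3 (K : Type u) [Field K] (L : Type v) [Lattice L] [BoundedOrder L] [Finite L]
    [LocallyFiniteOrder L] [DecidableEq L] (C : Finset L) (hC : IsStrongLatticeAntichain C) :
    IsPerfectRightModule (IncidenceAlgebra K L) (IncidenceAlgebra.AntichainModule K C) ↔
      IsBooleanLatticeAntichain C := by
  rw [IncidenceAlgebra.isPerfectRightModule_iff_forall_lt_card hC]
  constructor
  · exact fun h => IncidenceAlgebra.isBoolean_of_forall_ext (K := K) hC fun z i hi =>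
      IncidenceAlgebra.subsingleton_ext_rowModule K _ i (h i hi) z
  · exact fun hB i hi => IncidenceAlgebra.subsingleton_ext_self K _ i fun z =>
      IncidenceAlgebra.subsingleton_ext_of_isBoolean hB z i hi
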